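/- Let $M$ be a smooth finite-dimensional manifold (Hausdorff, second countable, without boundary), $E=TM\oplus T^*M$ with the pairing $\langle X+\xi,Y+\eta\rangle=\eta(X)+\xi(Y)$, and let $g$ be a pseudo-Riemannian metric on $M$ of arbitrary signature and $b$ a smooth $2$-form on $M$. Regard $g$ and $b$ as maps $TM\to T^*M$, $X\mapsto g(X,\cdot)$, $X\mapsto b(X,\cdot)$, and let $$G=\begin{pmatrix}-g^{-1}b & g^{-1}\\ g-bg^{-1}b & bg^{-1}\end{pmatrix}:E\to E$$ be the endomorphism induced by $(g,b)$. It satisfies $G^2=\mathrm{Id}$, and its $\pm1$-eigenbundles are $V^{\pm}=\{X\pm gX+bX\}$; write $X^{\pm}=X\pm gX+bX$. Let $[X+\xi,Y+\eta]_D=[X,Y]+\mathcal L_X\eta-\iota_Yd\xi$ and let $[v,w]_C=\frac12([v,w]_D-[w,v]_D)$ be the Courant bracket. Let $\nabla^+$ be the affine connection $\nabla^+_XY=\pi\big(\tfrac12(\mathrm{Id}+G)[X^-,Y^+]_C\big)$, where $\pi:E\to TM$ is the projection, and put $$[X+\xi,Y+\eta]_{\nabla^+}=[X,Y]+\nabla^+_X\eta-\nabla^+_Y\xi,\qquad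 \tilde\nabla_{X+\xi}(Y+\eta)=\nabla^+_XY+\nabla^+_X\eta .$$ $G$ is called $[\cdot,\cdot]_{\nabla^+}$-integrable if $$[Gv,Gw]_{\nabla^+}-G[Gv,w]_{\nabla^+}-G[v,Gw]_{\nabla^+}+G^2[v,w]_{\nabla^+}=0\quad\text{for all } v,w\in C^\infty(E),$$ and $[\cdot,\cdot]_C$-integrable if $C^\infty(V^+)$ is closed under $[\cdot,\cdot]_C$. Suppose that $\nabla^+b=0$ and $db=0$. Then: (i) $G$ is $[\cdot,\cdot]_{\nabla^+}$-integrable. (ii) If $\langle\tilde\nabla_uv,w\rangle=\langle\tilde\nabla_{Gu}v,Gw\rangle$ for all $u,v,w\in C^\infty(E)$, then $G$ is $[\cdot,\cdot]_C$-integrable. More precisely, this holds pair by pair: whenever $v,w\in C^\infty(V^+)$ satisfy $\langle\tilde\nabla_uv,w\rangle=\langle\tilde\nabla_{Gu}v,Gw\rangle$ and $\langle\tilde\nabla_uw,v\rangle=\langle\tilde\nabla_{Gu}w,Gv\rangle$ for all $u\in C^\infty(E)$, one has $[v,w]_C\in C^\infty(V^+)$. In particular, these integrability criteria hold irrespective of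 the signature of $g$. -/

import Mathlib

open Bundle
open scoped Manifold ContDiff Topology

noncomputable section

namespace GenGeom

section Calculus

variable {E : Type*} [NormedAddCommGroup E] [NormedSpace ℝ E]
  {M : Type*} [TopologicalSpace M] [ChartedSpace E M]

variable (E M) in
/-- (Not necessarily smooth) vector fields on `M`, i.e. sections of `TM`. -/
abbrev VField : Type _ := (x : M) → TangentSpace 𝓘(ℝ, E) x

variable (E M) in
/-- (Not necessarily smooth) one-forms on `M`, i.e. sections of `T*M`. -/
abbrev OneForm : Type _ := (x : M) → (TangentSpace 𝓘(ℝ, E) x →L[ℝ] ℝ)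

variable (E) in
/-- The fibre `T_xM ⊕ T_x*M` of the generalized tangent bundle. -/
abbrev GenFiber (x : M) : Type _ :=
  TangentSpace 𝓘(ℝ, E) x × (TangentSpace 𝓘(ℝ, E) x →L[ℝ] ℝ)

variable (E M) in
/-- (Not necessarily smooth) sections `X + ξ` of the generalized tangent bundle `TM ⊕ T*M`. -/
abbrev GenField : Type _ := (x : M) → GenFiber E x

variable [IsManifold 𝓘(ℝ, E) ∞ M]

/-- `X ∈ C^∞(TM)`. -/
def SmoothVField (X : VField E M) : Prop :=
  ContMDiff 𝓘(ℝ, E) (𝓘(ℝ, E).prod 𝓘(ℝ, E)) ∞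
    (fun x ↦ TotalSpace.mk' E x (X x))

/-- `ξ ∈ C^∞(T*M)`. -/
def SmoothOneForm (ξ : OneForm E M) : Prop :=
  ContMDiff 𝓘(ℝ, E) (𝓘(ℝ, E).prod 𝓘(ℝ, E →L[ℝ] ℝ)) ∞
    (fun x ↦ TotalSpace.mk' (E →L[ℝ] ℝ) x (ξ x))

/-- `X + ξ ∈ C^∞(TM ⊕ T*M)`. -/
def SmoothGenField (v : GenField E M) : Prop :=
  SmoothVField (fun x ↦ (v x).1) ∧ SmoothOneForm (fun x ↦ (v x).2)

/-- The derivative `X(f)` of a function along a vector field. -/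
def dirDeriv (X : VField E M) (f : M → ℝ) (x : M) : ℝ := mvfderiv 𝓘(ℝ, E) f x (X x)

/-- The function `ξ(X)`. -/
def evalForm (ξ : OneForm E M) (X : VField E M) (x : M) : ℝ := ξ x (X x)

/-- The Lie bracket of vector fields. -/
def lieBr (X Y : VField E M) : VField E M := VectorField.mlieBracket 𝓘(ℝ, E) X Y

variable [FiniteDimensional ℝ E]

open Classical in
/-- The one-form `θ` with `θ(Z) = Φ(Z)` for every vector field `Z`, where `Φ` is an operation from
vector fields to functions that is tensorial (additive and linear over functions).
The value is `0` at the points where `Φ` is not tensorial; this never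
happens below when the fields involved are smooth. -/
def formOf (Φ : VField E M → M → ℝ) : OneForm E M := fun x ↦
  have : IsManifold 𝓘(ℝ, E) 1 M := IsManifold.of_le (n := ∞) (by norm_cast)
  if h : TensorialAt 𝓘(ℝ, E) E (fun Z ↦ Φ Z x) x then
    TensorialAt.mkHom (fun Z ↦ Φ Z x) x h
  else 0

/-- The Lie derivative `L_X η` of a one-form: `(L_X η)(Z) = X(η(Z)) - η([X, Z])`. -/
def lieDerivForm (X : VField E M) (η : OneForm E M) : OneForm E M :=
  formOf fun Z x ↦ dirDeriv X (evalForm η Z) x - η x (lieBr X Z x)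

/-- The contraction `ι_Y dξ` of the exterior derivative of a one-form:
`(ι_Y dξ)(Z) = dξ(Y, Z) = Y(ξ(Z)) - Z(ξ(Y)) - ξ([Y, Z])`. -/
def contractD (Y : VField E M) (ξ : OneForm E M) : OneForm E M :=
  formOf fun Z x ↦ dirDeriv Y (evalForm ξ Z) x - dirDeriv Z (evalForm ξ Y) x - ξ x (lieBr Y Z x)

/-- The Dorfman bracket `[X + ξ, Y + η]_D = [X, Y] + L_X η - ι_Y dξ`. -/
def dorfman (v w : GenField E M) : GenField E M := fun x ↦
  (lieBr (fun y ↦ (v y).1) (fun y ↦ (w y).1) x,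
    lieDerivForm (fun y ↦ (v y).1) (fun y ↦ (w y).2) x
      - contractD (fun y ↦ (w y).1) (fun y ↦ (v y).2) x)

/-- The Courant bracket, the skew-symmetrization of the Dorfman bracket. -/
def courant (v w : GenField E M) : GenField E M := fun x ↦
  (1 / 2 : ℝ) • (dorfman v w x - dorfman w v x)

/-- The natural pairing `⟨X + ξ, Y + η⟩ = η(X) + ξ(Y)` on a fibre. -/
def pairing {x : M} (a c : GenFiber E x) : ℝ := c.2 a.1 + a.2 c.1

/-! ### Structures induced by an affine connection `∇`, given as the operation `(X, Y) ↦ ∇_X Y` -/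

/-- The covariant derivative of a one-form: `(∇_X η)(Z) = X(η(Z)) - η(∇_X Z)`. -/
def covForm (nabla : VField E M → VField E M → VField E M) (X : VField E M) (η : OneForm E M) :
    OneForm E M :=
  formOf fun Z x ↦ dirDeriv X (evalForm η Z) x - η x (nabla X Z x)

/-- The bracket `[X + ξ, Y + η]_∇ = [X, Y] + ∇_X η - ∇_Y ξ`. -/
def connBracket (nabla : VField E M → VField E M → VField E M) (v w : GenField E M) :
    GenField E M := fun x ↦
  (lieBr (fun y ↦ (v y).1) (fun y ↦ (w y).1) x,
    covForm nabla (fun y ↦ (v y).1) (fun y ↦ (w y).2) x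
      - covForm nabla (fun y ↦ (w y).1) (fun y ↦ (v y).2) x)

/-- The generalized connection `∇̃_{X + ξ} (Y + η) = ∇_X Y + ∇_X η`. -/
def genConn (nabla : VField E M → VField E M → VField E M) (v w : GenField E M) :
    GenField E M := fun x ↦
  (nabla (fun y ↦ (v y).1) (fun y ↦ (w y).1) x,
    covForm nabla (fun y ↦ (v y).1) (fun y ↦ (w y).2) x)

/-! ### Endomorphisms of the generalized tangent bundle -/

variable (E M) in
/-- (Not necessarily smooth) bundle endomorphisms of `TM ⊕ T*M`. -/
abbrev GenEndo : Type _ := (x : M) → (GenFiber E x →L[ℝ] GenFiber E x)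

/-- The section `J v`. -/
def GenEndo.app (J : GenEndo E M) (v : GenField E M) : GenField E M := fun x ↦ J x (v x)

/-- The Nijenhuis operator
`N_J(v, w) = [Jv, Jw] - J[Jv, w] - J[v, Jw] + J²[v, w]` with respect to a bracket. -/
def nijenhuis (br : GenField E M → GenField E M → GenField E M) (J : GenEndo E M)
    (v w : GenField E M) : GenField E M := fun x ↦
  br (J.app v) (J.app w) x - J x (br (J.app v) w x) - J x (br v (J.app w) x)
    + J x (J x (br v w x))

/-- The Nijenhuis operator with respect to the bracket vanishes. -/
def NijenhuisIntegrable (br : GenField E M → GenField E M → GenField E M) (J : GenEndo E M) :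
    Prop :=
  ∀ v w : GenField E M, SmoothGenField v → SmoothGenField w → ∀ x, nijenhuis br J v w x = 0

/-- `v` is a smooth section of the `+1`-eigenbundle `V⁺` of `J`. -/
def IsPlusSection (J : GenEndo E M) (v : GenField E M) : Prop :=
  SmoothGenField v ∧ ∀ x, J x (v x) = v x

/-- `[·,·]_C`-integrability of `J`: the Courant bracket of two smooth sections of the
`+1`-eigenbundle takes its values in the `+1`-eigenbundle. -/
def CourantIntegrable (J : GenEndo E M) : Prop :=
  ∀ v w : GenField E M, IsPlusSection J v → IsPlusSection J w →
    ∀ x, J x (courant v w x) = courant v w x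

end Calculus

section Metric

variable (E : Type*) [NormedAddCommGroup E] [NormedSpace ℝ E]
  (M : Type*) [TopologicalSpace M] [ChartedSpace E M] [IsManifold 𝓘(ℝ, E) ∞ M]

/-- A pseudo-Riemannian metric (of arbitrary signature) on `M`. -/
structure PseudoMetric where
  /-- The bilinear form on each tangent space; it is also the map `TM → T*M`, `X ↦ g(X, ·)`. -/
  val (x : M) : TangentSpace 𝓘(ℝ, E) x →L[ℝ] TangentSpace 𝓘(ℝ, E) x →L[ℝ] ℝ
  symm (x : M) (u v : TangentSpace 𝓘(ℝ, E) x) : val x u v = val x v u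
  nondegenerate (x : M) (u : TangentSpace 𝓘(ℝ, E) x) (hu : ∀ v, val x u v = 0) : u = 0
  smooth : ContMDiff 𝓘(ℝ, E) (𝓘(ℝ, E).prod 𝓘(ℝ, E →L[ℝ] E →L[ℝ] ℝ)) ∞
    (fun x ↦ TotalSpace.mk' (E →L[ℝ] E →L[ℝ] ℝ) x (val x))

/-- A smooth differential `2`-form on `M`. -/
structure TwoForm where
  /-- The skew form on each tangent space; it is also the map `TM → T*M`, `X ↦ ι_X b`. -/
  val (x : M) : TangentSpace 𝓘(ℝ, E) x →L[ℝ] TangentSpace 𝓘(ℝ, E) x →L[ℝ] ℝ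
  skew (x : M) (u v : TangentSpace 𝓘(ℝ, E) x) : val x u v = -val x v u
  smooth : ContMDiff 𝓘(ℝ, E) (𝓘(ℝ, E).prod 𝓘(ℝ, E →L[ℝ] E →L[ℝ] ℝ)) ∞
    (fun x ↦ TotalSpace.mk' (E →L[ℝ] E →L[ℝ] ℝ) x (val x))

end Metric

section GenMetric

variable {E : Type*} [NormedAddCommGroup E] [NormedSpace ℝ E]
  {M : Type*} [TopologicalSpace M] [ChartedSpace E M] [IsManifold 𝓘(ℝ, E) ∞ M]

/-- The function `b(X, Y)`. -/
def TwoForm.eval (b : TwoForm E M) (X Y : VField E M) (x : M) : ℝ := b.val x (X x) (Y x)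

/-- `db = 0`, with `db(X, Y, Z)` the cyclic sum of `X(b(Y, Z)) - b([X, Y], Z)`. -/
def TwoForm.IsClosed (b : TwoForm E M) : Prop :=
  ∀ X Y Z : VField E M, SmoothVField X → SmoothVField Y → SmoothVField Z → ∀ x,
    dirDeriv X (b.eval Y Z) x + dirDeriv Y (b.eval Z X) x + dirDeriv Z (b.eval X Y) x
      - b.eval (lieBr X Y) Z x - b.eval (lieBr Y Z) X x - b.eval (lieBr Z X) Y x = 0

/-- `∇b = 0`, with `(∇_X b)(Y, Z) = X(b(Y, Z)) - b(∇_X Y, Z) - b(Y, ∇_X Z)`. -/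
def TwoForm.IsParallel (b : TwoForm E M) (nabla : VField E M → VField E M → VField E M) : Prop :=
  ∀ X Y Z : VField E M, SmoothVField X → SmoothVField Y → SmoothVField Z → ∀ x,
    dirDeriv X (b.eval Y Z) x - b.eval (nabla X Y) Z x - b.eval Y (nabla X Z) x = 0

/-- The endomorphism of `TM ⊕ T*M` given by `X + ξ ↦ X + ξ + β X`, for `β : TM → T*M`. -/
def shear (β : (x : M) → TangentSpace 𝓘(ℝ, E) x →L[ℝ] TangentSpace 𝓘(ℝ, E) x →L[ℝ] ℝ) :
    GenEndo E M := fun x ↦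
  (ContinuousLinearMap.fst ℝ _ _).prod
    (ContinuousLinearMap.snd ℝ _ _ + (β x).comp (ContinuousLinearMap.fst ℝ _ _))

/-- The endomorphism `X + ξ ↦ g⁻¹ξ + gX`. -/
def PseudoMetric.endo (g : PseudoMetric E M) : GenEndo E M := fun x ↦
  ((g.val x).inverse.comp (ContinuousLinearMap.snd ℝ _ _)).prod
    ((g.val x).comp (ContinuousLinearMap.fst ℝ _ _))

/-- The endomorphism `G` of `TM ⊕ T*M` induced by `(g, b)`; as a block matrix
`G = [[-g⁻¹b, g⁻¹], [g - b g⁻¹ b, b g⁻¹]]`, where `g` and `b` stand for `X ↦ g(X, ·)` and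
`X ↦ b(X, ·)`. Its `±1`-eigenbundles are `V^± = {X ± gX + bX}`. -/
def genMetric (g : PseudoMetric E M) (b : TwoForm E M) : GenEndo E M := fun x ↦
  (shear b.val x).comp ((g.endo x).comp (shear (fun y ↦ -b.val y) x))

/-- The lift `X⁺ = X + gX + bX` of a vector field to `V⁺`. -/
def liftPlus (g : PseudoMetric E M) (b : TwoForm E M) (X : VField E M) : GenField E M :=
  fun x ↦ (X x, g.val x (X x) + b.val x (X x))

/-- The lift `X⁻ = X - gX + bX` of a vector field to `V⁻`. -/
def liftMinus (g : PseudoMetric E M) (b : TwoForm E M) (X : VField E M) : GenField E M :=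
  fun x ↦ (X x, -g.val x (X x) + b.val x (X x))

/-- The affine connection `∇⁺_X Y = π([X⁻, Y⁺]_C)₊` induced by `(g, b)`, where
`(·)₊ = (1/2)(Id + G)` is the projection onto `V⁺` along `V⁻` and `π` is the projection to `TM`. -/
def nablaPlus [FiniteDimensional ℝ E] (g : PseudoMetric E M) (b : TwoForm E M)
    (X Y : VField E M) : VField E M := fun x ↦
  ((1 / 2 : ℝ) • (courant (liftMinus g b X) (liftPlus g b Y) x
    + genMetric g b x (courant (liftMinus g b X) (liftPlus g b Y) x))).1

/-- The condition `⟨∇̃_u v, w⟩ = ⟨∇̃_{Gu} v, Gw⟩` for all smooth sections `u` (with `v`, `w` given),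
where `∇̃` is the generalized connection induced by `∇⁺`. -/
def SymmCondition [FiniteDimensional ℝ E] (g : PseudoMetric E M) (b : TwoForm E M)
    (v w : GenField E M) : Prop :=
  ∀ u : GenField E M, SmoothGenField u → ∀ x,
    pairing (genConn (nablaPlus g b) u v x) (w x) =
      pairing (genConn (nablaPlus g b) ((genMetric g b).app u) v x) ((genMetric g b).app w x)

end GenMetric

end GenGeom

end

set_option linter.unusedSectionVars false

/-! In general `∇⁺` is metric with torsion governed by `db`. When `db = 0` the `b`-terms in its
definition add up to `db` and drop out, leaving the Koszul formula (`koszul`), so `∇⁺` is the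
Levi-Civita connection of `g`. Since also `∇⁺b = 0`, the maps `g`, `g⁻¹` and `b` are all parallel,
and `G`, being built from them, commutes with `∇̃` (`genConn_genMetric`).

For (i), torsion-freeness gives `[v, w]_∇ = ∇̃_v w - ∇̃_w v` (`connBracket_eq`), and pulling `G` out
of every derivative makes the Nijenhuis expression cancel.

For (ii), sections of `V⁺` are lifts `X⁺`, and `⟨∇̃_u X⁺, Y⁺⟩ = 2g(∇_{πu}X, Y)`. Testing the
symmetry condition on `u = Z⁻` forces `g(∇_Z X, Y) = 0`. With `db = 0`, the failure of `[X⁺, Y⁺]_C`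
to lie in `V⁺`, evaluated on `Z`, is `g(∇_Z X, Y) - g(∇_Z Y, X)`, which therefore vanishes. The
metric enters only through symmetry and nondegeneracy, so its signature is irrelevant. -/

namespace GenGeom

/-! ### Calculus of sections differentiable at a point -/

section DifferentiableSections

variable {E : Type*} [NormedAddCommGroup E] [NormedSpace ℝ E]
  {M : Type*} [TopologicalSpace M] [ChartedSpace E M] [IsManifold 𝓘(ℝ, E) ∞ M]

/-- The vector field `X` is differentiable at `x`. -/
def VFieldDiffAt (X : VField E M) (x : M) : Prop :=
  MDifferentiableAt 𝓘(ℝ, E) (𝓘(ℝ, E).prod 𝓘(ℝ, E)) (fun y ↦ TotalSpace.mk' E y (X y)) x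

/-- The one-form `ξ` is differentiable at `x`. -/
def OneFormDiffAt (ξ : OneForm E M) (x : M) : Prop :=
  MDifferentiableAt 𝓘(ℝ, E) (𝓘(ℝ, E).prod 𝓘(ℝ, E →L[ℝ] ℝ))
    (fun y ↦ TotalSpace.mk' (E →L[ℝ] ℝ) y (ξ y)) x

/-- The function `f` is differentiable at `x`. -/
abbrev FunDiffAt (f : M → ℝ) (x : M) : Prop := MDifferentiableAt 𝓘(ℝ, E) 𝓘(ℝ) f x

variable {x : M} {X Y Z : VField E M} {ξ η : OneForm E M} {f h : M → ℝ}

theorem SmoothVField.diffAt (hX : SmoothVField X) (x : M) : VFieldDiffAt X x :=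
  (hX x).mdifferentiableAt (by simp)

theorem SmoothOneForm.diffAt (hξ : SmoothOneForm ξ) (x : M) : OneFormDiffAt ξ x :=
  (hξ x).mdifferentiableAt (by simp)

theorem VFieldDiffAt.add (hX : VFieldDiffAt X x) (hY : VFieldDiffAt Y x) :
    VFieldDiffAt (fun y ↦ X y + Y y) x :=
  have : IsManifold 𝓘(ℝ, E) 1 M := IsManifold.of_le (n := ∞) (by norm_cast)
  mdifferentiableAt_add_section hX hY

theorem VFieldDiffAt.smul (hf : FunDiffAt (E := E) f x) (hX : VFieldDiffAt X x) :
    VFieldDiffAt (fun y ↦ f y • X y) x :=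
  have : IsManifold 𝓘(ℝ, E) 1 M := IsManifold.of_le (n := ∞) (by norm_cast)
  MDifferentiableAt.smul_section hf hX

theorem OneFormDiffAt.add (hξ : OneFormDiffAt ξ x) (hη : OneFormDiffAt η x) :
    OneFormDiffAt (fun y ↦ ξ y + η y) x :=
  have : IsManifold 𝓘(ℝ, E) 1 M := IsManifold.of_le (n := ∞) (by norm_cast)
  mdifferentiableAt_add_section hξ hη

theorem OneFormDiffAt.neg (hξ : OneFormDiffAt ξ x) : OneFormDiffAt (fun y ↦ -ξ y) x :=
  have : IsManifold 𝓘(ℝ, E) 1 M := IsManifold.of_le (n := ∞) (by norm_cast)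
  mdifferentiableAt_neg_section hξ

theorem OneFormDiffAt.evalForm (hξ : OneFormDiffAt ξ x) (hX : VFieldDiffAt X x) :
    FunDiffAt (E := E) (evalForm ξ X) x := by
  have : IsManifold 𝓘(ℝ, E) 1 M := IsManifold.of_le (n := ∞) (by norm_cast)
  have h := MDifferentiableAt.clm_bundle_apply (E₂ := Bundle.Trivial M ℝ) (F₂ := ℝ)
    (b := fun y : M ↦ y) hξ hX
  exact ((mdifferentiableAt_totalSpace _ _).1 h).2

theorem SmoothOneForm.add (hξ : SmoothOneForm ξ) (hη : SmoothOneForm η) :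
    SmoothOneForm (fun y ↦ ξ y + η y) :=
  ContMDiff.add_section hξ hη

theorem SmoothOneForm.neg (hξ : SmoothOneForm ξ) : SmoothOneForm (fun y ↦ -ξ y) :=
  ContMDiff.neg_section hξ

theorem SmoothVField.neg (hX : SmoothVField X) : SmoothVField (fun y ↦ -X y) :=
  ContMDiff.neg_section hX

theorem dirDeriv_add (hf : FunDiffAt (E := E) f x) (hh : FunDiffAt (E := E) h x) :
    dirDeriv X (fun y ↦ f y + h y) x = dirDeriv X f x + dirDeriv X h x := by
  simp [dirDeriv, mvfderiv_fun_add hf hh]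

theorem dirDeriv_sub (hf : FunDiffAt (E := E) f x) (hh : FunDiffAt (E := E) h x) :
    dirDeriv X (fun y ↦ f y - h y) x = dirDeriv X f x - dirDeriv X h x := by
  simp [dirDeriv, mvfderiv_fun_sub hf hh]

theorem dirDeriv_neg : dirDeriv X (fun y ↦ -f y) x = -dirDeriv X f x := by
  simp [dirDeriv, mvfderiv_fun_neg]

theorem dirDeriv_mul (hf : FunDiffAt (E := E) f x) (hh : FunDiffAt (E := E) h x) :
    dirDeriv X (fun y ↦ f y * h y) x = f x * dirDeriv X h x + h x * dirDeriv X f x := by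
  simp [dirDeriv, mvfderiv_fun_mul hf hh]

theorem lieBr_swap (X Y : VField E M) (x : M) : lieBr X Y x = -lieBr Y X x :=
  VectorField.mlieBracket_swap_apply

variable [FiniteDimensional ℝ E]

theorem lieBr_add_right (hY : VFieldDiffAt Y x) (hZ : VFieldDiffAt Z x) :
    lieBr X (fun y ↦ Y y + Z y) x = lieBr X Y x + lieBr X Z x :=
  have : IsManifold 𝓘(ℝ, E) 2 M := IsManifold.of_le (n := ∞) (by norm_cast)
  have : CompleteSpace E := FiniteDimensional.complete ℝ E
  VectorField.mlieBracket_add_right hY hZ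

theorem lieBr_smul_right (hf : FunDiffAt (E := E) f x) (hY : VFieldDiffAt Y x) :
    lieBr X (fun y ↦ f y • Y y) x = dirDeriv X f x • Y x + f x • lieBr X Y x :=
  have : IsManifold 𝓘(ℝ, E) 2 M := IsManifold.of_le (n := ∞) (by norm_cast)
  have : CompleteSpace E := FiniteDimensional.complete ℝ E
  VectorField.mlieBracket_smul_right hf hY

theorem lieBr_smul_left (hf : FunDiffAt (E := E) f x) (hY : VFieldDiffAt Y x) :
    lieBr (fun y ↦ f y • Y y) X x = -dirDeriv X f x • Y x + f x • lieBr Y X x :=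
  have : IsManifold 𝓘(ℝ, E) 2 M := IsManifold.of_le (n := ∞) (by norm_cast)
  have : CompleteSpace E := FiniteDimensional.complete ℝ E
  VectorField.mlieBracket_smul_left hf hY

theorem lieBr_add_left (hY : VFieldDiffAt Y x) (hZ : VFieldDiffAt Z x) :
    lieBr (fun y ↦ Y y + Z y) X x = lieBr Y X x + lieBr Z X x :=
  have : IsManifold 𝓘(ℝ, E) 2 M := IsManifold.of_le (n := ∞) (by norm_cast)
  have : CompleteSpace E := FiniteDimensional.complete ℝ E
  VectorField.mlieBracket_add_left hY hZ

/-! ### Tensorial operations and the Courant bracket -/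

theorem exists_smoothVField_eq [T2Space M] (x : M) (u : TangentSpace 𝓘(ℝ, E) x) :
    ∃ X : VField E M, SmoothVField X ∧ X x = u := by
  obtain ⟨s, hs, hsX⟩ := FiberBundle.exists_contMDiffOn_extend (k := ∞) 𝓘(ℝ, E) E u
  -- The bump function is supported where the local extension of `u` is smooth, and equals 1 at `x`.
  obtain ⟨ψ, hψ⟩ := ((SmoothBumpFunction.nhds_basis_tsupport
    (I := 𝓘(ℝ, E)) x).mem_iff).1 (interior_mem_nhds.2 hs)
  refine ⟨fun y ↦ ψ y • FiberBundle.extend E u y, ?_, by simp⟩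
  exact ContMDiffOn.smul_section_of_tsupport (u := interior s) ψ.contMDiff.contMDiffOn
    isOpen_interior hψ.2 (hsX.mono interior_subset)

/-- The operation `Φ` on vector fields is additive and function-linear at `x`. -/
structure IsTensorial (Φ : VField E M → M → ℝ) (x : M) : Prop where
  smul : ∀ {f : M → ℝ} {Z : VField E M}, FunDiffAt (E := E) f x → VFieldDiffAt Z x →
    Φ (fun y ↦ f y • Z y) x = f x * Φ Z x
  add : ∀ {Y Z : VField E M}, VFieldDiffAt Y x → VFieldDiffAt Z x →
    Φ (fun y ↦ Y y + Z y) x = Φ Y x + Φ Z x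

theorem IsTensorial.tensorialAt {Φ : VField E M → M → ℝ} (h : IsTensorial Φ x) :
    TensorialAt 𝓘(ℝ, E) E (fun Z ↦ Φ Z x) x :=
  ⟨fun hf hZ ↦ h.smul hf hZ, fun hY hZ ↦ h.add hY hZ⟩

theorem IsTensorial.pointwise {Φ : VField E M → M → ℝ} (h : IsTensorial Φ x)
    (hY : VFieldDiffAt Y x) (hZ : VFieldDiffAt Z x) (hYZ : Y x = Z x) : Φ Y x = Φ Z x :=
  have : IsManifold 𝓘(ℝ, E) 1 M := IsManifold.of_le (n := ∞) (by norm_cast)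
  h.tensorialAt.pointwise hY hZ hYZ

/-- The default value 0 in `formOf` is excluded by tensoriality. Tensoriality is tested on fields
merely differentiable at `x`, which dictates the regularity of many of the later lemmas. -/
theorem formOf_apply {Φ : VField E M → M → ℝ} (h : IsTensorial Φ x) (hZ : VFieldDiffAt Z x) :
    formOf Φ x (Z x) = Φ Z x := by
  have : IsManifold 𝓘(ℝ, E) 1 M := IsManifold.of_le (n := ∞) (by norm_cast)
  rw [formOf, dif_pos h.tensorialAt]
  exact TensorialAt.mkHom_apply h.tensorialAt hZ

theorem evalForm_smul : evalForm ξ (fun y ↦ f y • X y) = fun y ↦ f y * evalForm ξ X y := by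
  ext y; simp [evalForm]

theorem evalForm_add : evalForm ξ (fun y ↦ X y + Y y) =
    fun y ↦ evalForm ξ X y + evalForm ξ Y y := by
  ext y; simp [evalForm]

theorem lieDerivForm_apply (hη : OneFormDiffAt η x) (hZ : VFieldDiffAt Z x) :
    lieDerivForm X η x (Z x) = dirDeriv X (evalForm η Z) x - η x (lieBr X Z x) := by
  refine formOf_apply ⟨fun hf hZ ↦ ?_, fun hY hZ ↦ ?_⟩ hZ
  · rw [evalForm_smul, dirDeriv_mul hf (hη.evalForm hZ), lieBr_smul_right hf hZ]
    simp [evalForm]; ring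
  · rw [evalForm_add, dirDeriv_add (hη.evalForm hY) (hη.evalForm hZ), lieBr_add_right hY hZ]
    simp; ring

theorem dirDeriv_smul_left : dirDeriv (fun y ↦ f y • X y) h x = f x * dirDeriv X h x := by
  simp [dirDeriv]

theorem dirDeriv_add_left :
    dirDeriv (fun y ↦ X y + Y y) h x = dirDeriv X h x + dirDeriv Y h x := by
  simp [dirDeriv]

theorem contractD_apply (hξ : OneFormDiffAt ξ x) (hZ : VFieldDiffAt Z x) :
    contractD Y ξ x (Z x) = dirDeriv Y (evalForm ξ Z) x - dirDeriv Z (evalForm ξ Y) x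
      - ξ x (lieBr Y Z x) := by
  refine formOf_apply ⟨fun hf hZ ↦ ?_, fun hY hZ ↦ ?_⟩ hZ
  · rw [evalForm_smul, dirDeriv_mul hf (hξ.evalForm hZ), lieBr_smul_right hf hZ,
      dirDeriv_smul_left]
    simp [evalForm]; ring
  · rw [evalForm_add, dirDeriv_add (hξ.evalForm hY) (hξ.evalForm hZ), lieBr_add_right hY hZ,
      dirDeriv_add_left]
    simp; ring

theorem fst_courant (v w : GenField E M) (x : M) :
    (courant v w x).1 = lieBr (fun y ↦ (v y).1) (fun y ↦ (w y).1) x := by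
  simp only [courant, dorfman, Prod.smul_fst, Prod.fst_sub]
  rw [lieBr_swap (fun y ↦ (w y).1)]
  module

/-- By Cartan's formula `L_X η + ι_X dη = 2 L_X η - d(η(X))`; the factor 2 clears the 1/2 of the
Courant bracket. -/
theorem two_snd_courant_apply {v w : GenField E M}
    (hξ : OneFormDiffAt (fun y ↦ (v y).2) x) (hη : OneFormDiffAt (fun y ↦ (w y).2) x)
    (hZ : VFieldDiffAt Z x) :
    2 * (courant v w x).2 (Z x) =
      2 * dirDeriv (fun y ↦ (v y).1) (evalForm (fun y ↦ (w y).2) Z) x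
      - 2 * dirDeriv (fun y ↦ (w y).1) (evalForm (fun y ↦ (v y).2) Z) x
      - 2 * (w x).2 (lieBr (fun y ↦ (v y).1) Z x) + 2 * (v x).2 (lieBr (fun y ↦ (w y).1) Z x)
      - dirDeriv Z (evalForm (fun y ↦ (w y).2) (fun y ↦ (v y).1)) x
      + dirDeriv Z (evalForm (fun y ↦ (v y).2) (fun y ↦ (w y).1)) x := by
  simp only [courant, dorfman, Prod.smul_snd, Prod.snd_sub, smul_apply, sub_apply,
    smul_eq_mul]
  rw [lieDerivForm_apply hη hZ, lieDerivForm_apply hξ hZ, contractD_apply hη hZ,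
    contractD_apply hξ hZ]
  ring

end DifferentiableSections

/-! ### Nondegenerate forms and the smooth inverse metric -/

theorem isInvertible_of_nondegenerate {E : Type*} [NormedAddCommGroup E] [NormedSpace ℝ E]
    [FiniteDimensional ℝ E] (β : E →L[ℝ] E →L[ℝ] ℝ) (hβ : ∀ u, (∀ v, β u v = 0) → u = 0) :
    β.IsInvertible := by
  have hinj : Function.Injective (β : E →ₗ[ℝ] E →L[ℝ] ℝ) :=
    (injective_iff_map_eq_zero _).2 fun u hu ↦ hβ u fun v ↦ by
      simpa using congrArg (fun φ : E →L[ℝ] ℝ ↦ φ v) hu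
  have hrank : Module.finrank ℝ E = Module.finrank ℝ (E →L[ℝ] ℝ) := by
    rw [← (LinearMap.toContinuousLinearMap : (E →ₗ[ℝ] ℝ) ≃ₗ[ℝ] E →L[ℝ] ℝ).finrank_eq]
    exact (Subspace.dual_finrank_eq).symm
  exact ⟨(LinearEquiv.ofInjectiveOfFinrankEq _ hinj hrank).toContinuousLinearEquiv,
    ContinuousLinearMap.ext fun _ ↦ rfl⟩

section Bilinear

variable {E : Type*} [NormedAddCommGroup E] [NormedSpace ℝ E]
  {M : Type*} [TopologicalSpace M] [ChartedSpace E M] [IsManifold 𝓘(ℝ, E) ∞ M]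
  {β : (x : M) → TangentSpace 𝓘(ℝ, E) x →L[ℝ] TangentSpace 𝓘(ℝ, E) x →L[ℝ] ℝ}
  {x : M} {X Y Z : VField E M} {ξ : OneForm E M}

/-- `β` is a smooth field of bilinear forms. -/
def SmoothBilin
    (β : (x : M) → TangentSpace 𝓘(ℝ, E) x →L[ℝ] TangentSpace 𝓘(ℝ, E) x →L[ℝ] ℝ) : Prop :=
  ContMDiff 𝓘(ℝ, E) (𝓘(ℝ, E).prod 𝓘(ℝ, E →L[ℝ] E →L[ℝ] ℝ)) ∞
    (fun x ↦ TotalSpace.mk' (E →L[ℝ] E →L[ℝ] ℝ) x (β x))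

theorem SmoothBilin.apply (hβ : SmoothBilin β) (hX : SmoothVField X) :
    SmoothOneForm (fun y ↦ β y (X y)) :=
  ContMDiff.clm_bundle_apply (b := fun y : M ↦ y) hβ hX

theorem SmoothBilin.apply_diffAt (hβ : SmoothBilin β) (hX : VFieldDiffAt X x) :
    OneFormDiffAt (fun y ↦ β y (X y)) x :=
  have : IsManifold 𝓘(ℝ, E) 1 M := IsManifold.of_le (n := ∞) (by norm_cast)
  MDifferentiableAt.clm_bundle_apply (b := fun y : M ↦ y)
    ((hβ x).mdifferentiableAt (by simp)) hX

theorem SmoothBilin.apply₂_diffAt (hβ : SmoothBilin β) (hX : VFieldDiffAt X x)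
    (hY : VFieldDiffAt Y x) : FunDiffAt (E := E) (fun y ↦ β y (X y) (Y y)) x :=
  (hβ.apply_diffAt hX).evalForm hY

namespace PseudoMetric

variable (g : PseudoMetric E M)

theorem smoothBilin : SmoothBilin g.val := g.smooth

theorem ext_of_val {u u' : TangentSpace 𝓘(ℝ, E) x} (h : ∀ v, g.val x u v = g.val x u' v) :
    u = u' :=
  sub_eq_zero.1 <| g.nondegenerate x _ fun v ↦ by simp [h v]

variable [FiniteDimensional ℝ E]

theorem isInvertible (x : M) : (g.val x).IsInvertible :=
  isInvertible_of_nondegenerate (E := E) (g.val x) (g.nondegenerate x)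

theorem val_inverse (ξ : TangentSpace 𝓘(ℝ, E) x →L[ℝ] ℝ) :
    g.val x ((g.val x).inverse ξ) = ξ :=
  (g.isInvertible x).self_apply_inverse ξ

theorem inverse_val (u : TangentSpace 𝓘(ℝ, E) x) : (g.val x).inverse (g.val x u) = u :=
  (g.isInvertible x).inverse_apply_self u

/-- In local trivializations `g⁻¹` is the inverse of the coordinate expression of `g`, and inversion
of operators is smooth at invertible ones. -/
theorem smooth_inverse (hξ : SmoothOneForm ξ) :
    SmoothVField (fun y ↦ (g.val y).inverse (ξ y)) := by
  have : CompleteSpace E := FiniteDimensional.complete ℝ E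
  intro x
  refine ContMDiffAt.clm_apply_of_inCoordinates (b₁ := fun y : M ↦ y) (b₂ := fun y : M ↦ y)
    (F₁ := E →L[ℝ] ℝ) (E₁ := fun y : M ↦ TangentSpace 𝓘(ℝ, E) y →L[ℝ] ℝ)
    (F₂ := E) (E₂ := fun y : M ↦ TangentSpace 𝓘(ℝ, E) y) ?_ (hξ x) contMDiffAt_id
  have hg := ((contMDiffAt_hom_bundle _).1 (g.smooth x)).2
  have hinv : ContMDiffAt 𝓘(ℝ, E) 𝓘(ℝ, (E →L[ℝ] ℝ) →L[ℝ] E) ∞ (fun y ↦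
      (ContinuousLinearMap.inCoordinates E (fun y : M ↦ TangentSpace 𝓘(ℝ, E) y) (E →L[ℝ] ℝ)
        (fun y : M ↦ TangentSpace 𝓘(ℝ, E) y →L[ℝ] ℝ) x y x y (g.val y)).inverse) x := by
    refine ContMDiffAt.comp x (g := ContinuousLinearMap.inverse) ?_ hg
    apply ContDiffAt.contMDiffAt
    apply ContinuousLinearMap.IsInvertible.contDiffAt_map_inverse
    rw [ContinuousLinearMap.inCoordinates_eq (FiberBundle.mem_baseSet_trivializationAt' x)
      (FiberBundle.mem_baseSet_trivializationAt' x)]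
    exact ContinuousLinearMap.isInvertible_equiv.comp
      ((g.isInvertible x).comp ContinuousLinearMap.isInvertible_equiv)
  refine hinv.congr_of_eventuallyEq ?_
  filter_upwards [(trivializationAt E (fun y : M ↦ TangentSpace 𝓘(ℝ, E) y) x).open_baseSet.mem_nhds
      (FiberBundle.mem_baseSet_trivializationAt' x),
    (trivializationAt (E →L[ℝ] ℝ)
      (fun y : M ↦ TangentSpace 𝓘(ℝ, E) y →L[ℝ] ℝ) x).open_baseSet.mem_nhds
      (FiberBundle.mem_baseSet_trivializationAt' x)] with y hy hy'
  rw [ContinuousLinearMap.inCoordinates_eq hy hy', ContinuousLinearMap.inCoordinates_eq hy' hy]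
  simp only [ContinuousLinearMap.inverse_equiv_comp, ContinuousLinearMap.inverse_comp_equiv,
    ContinuousLinearEquiv.symm_symm]
  rfl

end PseudoMetric

end Bilinear

/-! ### The connection `∇⁺` and its Koszul formula -/

section Connection

variable {E : Type*} [NormedAddCommGroup E] [NormedSpace ℝ E] [FiniteDimensional ℝ E]
  {M : Type*} [TopologicalSpace M] [ChartedSpace E M] [IsManifold 𝓘(ℝ, E) ∞ M]
  {x : M} {X Y Z : VField E M} {ξ η : OneForm E M} {f : M → ℝ}
  {g : PseudoMetric E M} {b : TwoForm E M}

/-- The function `g(X, Y)`. -/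
noncomputable def PseudoMetric.eval (g : PseudoMetric E M) (X Y : VField E M) (x : M) : ℝ := g.val x (X x) (Y x)

theorem PseudoMetric.eval_comm (g : PseudoMetric E M) (X Y : VField E M) :
    g.eval X Y = g.eval Y X := funext fun x ↦ g.symm x _ _

theorem PseudoMetric.eval_diffAt (g : PseudoMetric E M) (hX : VFieldDiffAt X x)
    (hY : VFieldDiffAt Y x) : FunDiffAt (E := E) (g.eval X Y) x :=
  g.smoothBilin.apply₂_diffAt hX hY

theorem TwoForm.smoothBilin (b : TwoForm E M) : SmoothBilin b.val := b.smooth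

theorem TwoForm.eval_swap (b : TwoForm E M) (X Y : VField E M) :
    b.eval X Y = fun y ↦ -b.eval Y X y := funext fun x ↦ b.skew x _ _

theorem TwoForm.eval_diffAt (b : TwoForm E M) (hX : VFieldDiffAt X x)
    (hY : VFieldDiffAt Y x) : FunDiffAt (E := E) (b.eval X Y) x :=
  b.smoothBilin.apply₂_diffAt hX hY

/-- In `db = 0`, one of the three vector fields need only be differentiable at the point. -/
theorem TwoForm.IsClosed.of_diffAt [T2Space M] (hb : b.IsClosed) (hX : SmoothVField X)
    (hY : VFieldDiffAt Y x) (hZ : SmoothVField Z) :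
    dirDeriv X (b.eval Y Z) x + dirDeriv Y (b.eval Z X) x + dirDeriv Z (b.eval X Y) x
      - b.eval (lieBr X Y) Z x - b.eval (lieBr Y Z) X x - b.eval (lieBr Z X) Y x = 0 := by
  -- The cyclic expression is tensorial in `Y`: the derivatives of `f` from the differentiated and
  -- the bracket terms cancel, using skewness of `b`. Only the value `Y x` matters, so a smooth
  -- field with that value may replace `Y`.
  obtain ⟨Y', hY', hYY'⟩ := exists_smoothVField_eq x (Y x)
  rw [← hb X Y' Z hX hY' hZ x]
  refine IsTensorial.pointwise (Φ := fun Y x ↦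
    dirDeriv X (b.eval Y Z) x + dirDeriv Y (b.eval Z X) x + dirDeriv Z (b.eval X Y) x
      - b.eval (lieBr X Y) Z x - b.eval (lieBr Y Z) X x - b.eval (lieBr Z X) Y x)
    ⟨fun {f Y} hf hY ↦ ?_, fun {Y Y'} hY hY' ↦ ?_⟩ hY (hY'.diffAt x) hYY'.symm
  · have h₁ : b.eval (fun y ↦ f y • Y y) Z = fun y ↦ f y * b.eval Y Z y := by
      ext; simp [TwoForm.eval]
    have h₂ : b.eval X (fun y ↦ f y • Y y) = fun y ↦ f y * b.eval X Y y := by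
      ext; simp [TwoForm.eval]
    rw [h₁, h₂, dirDeriv_mul hf (b.eval_diffAt hY (hZ.diffAt x)),
      dirDeriv_mul hf (b.eval_diffAt (hX.diffAt x) hY), dirDeriv_smul_left]
    simp only [TwoForm.eval, lieBr_smul_left hf hY, lieBr_smul_right hf hY, map_add, map_smul,
      add_apply, smul_apply, smul_eq_mul, b.skew x (X x) (Y x)]
    ring
  · have h₁ : b.eval (fun y ↦ Y y + Y' y) Z = fun y ↦ b.eval Y Z y + b.eval Y' Z y := by
      ext; simp [TwoForm.eval]
    have h₂ : b.eval X (fun y ↦ Y y + Y' y) = fun y ↦ b.eval X Y y + b.eval X Y' y := by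
      ext; simp [TwoForm.eval]
    rw [h₁, h₂, dirDeriv_add (b.eval_diffAt hY (hZ.diffAt x)) (b.eval_diffAt hY' (hZ.diffAt x)),
      dirDeriv_add (b.eval_diffAt (hX.diffAt x) hY) (b.eval_diffAt (hX.diffAt x) hY'),
      dirDeriv_add_left]
    simp only [TwoForm.eval, lieBr_add_left hY hY', lieBr_add_right hY hY', map_add, add_apply]
    ring

theorem genMetric_apply (a : GenFiber E x) : genMetric g b x a =
    ((g.val x).inverse (a.2 - b.val x a.1),
      g.val x a.1 + b.val x ((g.val x).inverse (a.2 - b.val x a.1))) := by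
  simp [genMetric, shear, PseudoMetric.endo, sub_eq_add_neg]

theorem genMetric_eq_self_iff (a : GenFiber E x) :
    genMetric g b x a = a ↔ a.2 = g.val x a.1 + b.val x a.1 := by
  rw [genMetric_apply]
  constructor
  · intro h
    have h₁ := congrArg (g.val x) (congrArg Prod.fst h)
    rw [g.val_inverse] at h₁
    rw [← h₁]; simp
  · intro h
    ext1 <;> simp [h, g.inverse_val]

/-- The tangent part of `G(A + α)` is `g⁻¹(α - bA)`; applying `2g` clears both the inverse and the
1/2 of the projection. -/
theorem two_val_nablaPlus (X Y : VField E M) (x : M) (u : TangentSpace 𝓘(ℝ, E) x) :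
    2 * g.val x (nablaPlus g b X Y x) u = g.val x (lieBr X Y x) u
      + (courant (liftMinus g b X) (liftPlus g b Y) x).2 u - b.val x (lieBr X Y x) u := by
  have h : (courant (liftMinus g b X) (liftPlus g b Y) x).1 = lieBr X Y x := fst_courant ..
  rw [nablaPlus, genMetric_apply, h]
  simp only [Prod.smul_fst, Prod.fst_add, h, map_smul, map_add, g.val_inverse, smul_apply,
    add_apply, sub_apply, smul_eq_mul]
  ring

/-- The Koszul formula for `∇⁺` when `db = 0`. -/
theorem koszul [T2Space M] (hb : b.IsClosed) (hX : SmoothVField X) (hY : VFieldDiffAt Y x)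
    (hZ : SmoothVField Z) :
    2 * g.val x (nablaPlus g b X Y x) (Z x) =
      dirDeriv X (g.eval Y Z) x + dirDeriv Y (g.eval X Z) x - dirDeriv Z (g.eval X Y) x
        + g.val x (lieBr X Y x) (Z x) - g.val x (lieBr X Z x) (Y x)
        - g.val x (lieBr Y Z x) (X x) := by
  have hXx := hX.diffAt x
  have hZx := hZ.diffAt x
  have hc := two_snd_courant_apply (v := liftMinus g b X) (w := liftPlus g b Y)
    ((g.smoothBilin.apply_diffAt hXx).neg.add (b.smoothBilin.apply_diffAt hXx))
    ((g.smoothBilin.apply_diffAt hY).add (b.smoothBilin.apply_diffAt hY)) hZx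
  have h₁ : evalForm (fun y ↦ (liftPlus g b Y y).2) Z = fun y ↦ g.eval Y Z y + b.eval Y Z y := rfl
  have h₂ : evalForm (fun y ↦ (liftMinus g b X y).2) Z =
      fun y ↦ b.eval X Z y - g.eval X Z y := by
    ext; simp [evalForm, liftMinus, PseudoMetric.eval, TwoForm.eval]; ring
  have h₃ : evalForm (fun y ↦ (liftPlus g b Y y).2) (fun y ↦ (liftMinus g b X y).1) =
      fun y ↦ g.eval X Y y - b.eval X Y y := by
    rw [g.eval_comm, b.eval_swap X Y]
    ext; simp [evalForm, liftMinus, liftPlus, PseudoMetric.eval, TwoForm.eval]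
  have h₄ : evalForm (fun y ↦ (liftMinus g b X y).2) (fun y ↦ (liftPlus g b Y y).1) =
      fun y ↦ b.eval X Y y - g.eval X Y y := by
    ext; simp [evalForm, liftMinus, liftPlus, PseudoMetric.eval, TwoForm.eval]; ring
  have gYZ := g.eval_diffAt hY hZx
  have gXZ := g.eval_diffAt hXx hZx
  have gXY := g.eval_diffAt hXx hY
  have bYZ := b.eval_diffAt hY hZx
  have bXZ := b.eval_diffAt hXx hZx
  have bXY := b.eval_diffAt hXx hY
  rw [h₁, h₂, h₃, h₄, dirDeriv_add gYZ bYZ, dirDeriv_sub bXZ gXZ, dirDeriv_sub gXY bXY,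
    dirDeriv_sub bXY gXY] at hc
  -- The `b`-terms of the expanded bracket, together with `-b([X, Y], Z)`, are exactly `db(X, Y,
  -- Z)`.
  have hd := hb.of_diffAt hX hY hZ
  rw [b.eval_swap Z X, dirDeriv_neg] at hd
  rw [two_val_nablaPlus]
  simp only [liftPlus, liftMinus, TwoForm.eval, lieBr_swap Z X, map_neg, neg_apply,
    add_apply] at hc hd ⊢
  linarith [g.symm x (Y x) (lieBr X Z x), b.skew x (Y x) (lieBr X Z x),
    g.symm x (X x) (lieBr Y Z x), b.skew x (X x) (lieBr Y Z x)]

end Connection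

/-! ### `∇⁺` as Levi-Civita connection, and integrability for the bracket of `∇⁺` -/

section LeviCivita

variable {E : Type*} [NormedAddCommGroup E] [NormedSpace ℝ E] [FiniteDimensional ℝ E]
  {M : Type*} [TopologicalSpace M] [T2Space M] [ChartedSpace E M] [IsManifold 𝓘(ℝ, E) ∞ M]
  {x : M} {X Y Z : VField E M} {ξ η : OneForm E M} {f : M → ℝ}
  {g : PseudoMetric E M} {b : TwoForm E M}

theorem eq_of_val_smooth {u u' : TangentSpace 𝓘(ℝ, E) x}
    (h : ∀ Z, SmoothVField Z → g.val x u (Z x) = g.val x u' (Z x)) : u = u' := by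
  refine g.ext_of_val fun v ↦ ?_
  obtain ⟨Z, hZ, rfl⟩ := exists_smoothVField_eq x v
  exact h Z hZ

theorem form_ext_smooth {α β : TangentSpace 𝓘(ℝ, E) x →L[ℝ] ℝ}
    (h : ∀ Z, SmoothVField Z → α (Z x) = β (Z x)) : α = β := by
  ext v
  obtain ⟨Z, hZ, rfl⟩ := exists_smoothVField_eq x v
  exact h Z hZ

theorem nablaPlus_add (hb : b.IsClosed) (hX : SmoothVField X) (hY : VFieldDiffAt Y x)
    (hZ : VFieldDiffAt Z x) :
    nablaPlus g b X (fun y ↦ Y y + Z y) x = nablaPlus g b X Y x + nablaPlus g b X Z x := by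
  refine eq_of_val_smooth (g := g) fun W hW ↦ ?_
  have h := koszul (g := g) hb hX (hY.add hZ) hW
  have hXx := hX.diffAt x
  have hWx := hW.diffAt x
  have h₁ : g.eval (fun y ↦ Y y + Z y) W = fun y ↦ g.eval Y W y + g.eval Z W y := by
    ext; simp [PseudoMetric.eval]
  have h₂ : g.eval X (fun y ↦ Y y + Z y) = fun y ↦ g.eval X Y y + g.eval X Z y := by
    ext; simp [PseudoMetric.eval]
  rw [h₁, h₂, dirDeriv_add (g.eval_diffAt hY hWx) (g.eval_diffAt hZ hWx),
    dirDeriv_add (g.eval_diffAt hXx hY) (g.eval_diffAt hXx hZ), dirDeriv_add_left,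
    lieBr_add_left hY hZ, lieBr_add_right hY hZ] at h
  simp only [map_add, add_apply] at h ⊢
  linarith [koszul (g := g) hb hX hY hW, koszul (g := g) hb hX hZ hW]

/-- In the Koszul formula the `X(f)`-terms from `X(g(fY, W))` and from `[X, fY]` add up, while the
`W(f)`-terms cancel. -/
theorem nablaPlus_smul (hb : b.IsClosed) (hX : SmoothVField X)
    (hf : FunDiffAt (E := E) f x) (hY : VFieldDiffAt Y x) :
    nablaPlus g b X (fun y ↦ f y • Y y) x = dirDeriv X f x • Y x + f x • nablaPlus g b X Y x := by
  refine eq_of_val_smooth (g := g) fun W hW ↦ ?_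
  have h := koszul (g := g) hb hX (hY.smul hf) hW
  have hXx := hX.diffAt x
  have hWx := hW.diffAt x
  have h₁ : g.eval (fun y ↦ f y • Y y) W = fun y ↦ f y * g.eval Y W y := by
    ext; simp [PseudoMetric.eval]
  have h₂ : g.eval X (fun y ↦ f y • Y y) = fun y ↦ f y * g.eval X Y y := by
    ext; simp [PseudoMetric.eval]
  rw [h₁, h₂, dirDeriv_mul hf (g.eval_diffAt hY hWx), dirDeriv_mul hf (g.eval_diffAt hXx hY),
    dirDeriv_smul_left, lieBr_smul_left hf hY, lieBr_smul_right hf hY] at h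
  simp only [map_add, map_smul, add_apply, smul_apply, smul_eq_mul, PseudoMetric.eval,
    g.symm x (X x) (Y x)] at h ⊢
  have hk := koszul (g := g) hb hX hY hW
  linear_combination (1 / 2) * h - (1 / 2) * f x * hk

/-- The Leibniz terms `X(f) η(Z)` cancel, so the defining operation is tensorial. This needs the
Leibniz rule for `Z` differentiable only at `x`, hence the weak assumption on `Y` in `koszul`. -/
theorem covForm_apply (hb : b.IsClosed) (hX : SmoothVField X) (hη : OneFormDiffAt η x)
    (hZ : VFieldDiffAt Z x) :
    covForm (nablaPlus g b) X η x (Z x) =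
      dirDeriv X (evalForm η Z) x - η x (nablaPlus g b X Z x) := by
  refine formOf_apply ⟨fun hf hZ ↦ ?_, fun hY hZ ↦ ?_⟩ hZ
  · rw [evalForm_smul, dirDeriv_mul hf (hη.evalForm hZ), nablaPlus_smul hb hX hf hZ]
    simp [evalForm]; ring
  · rw [evalForm_add, dirDeriv_add (hη.evalForm hY) (hη.evalForm hZ), nablaPlus_add hb hX hY hZ]
    simp; ring

/-- `∇⁺` is torsion-free when `db = 0`. -/
theorem nablaPlus_torsionFree (hb : b.IsClosed) (hX : SmoothVField X) (hY : SmoothVField Y) :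
    lieBr X Y x = nablaPlus g b X Y x - nablaPlus g b Y X x := by
  refine eq_of_val_smooth (g := g) fun Z hZ ↦ ?_
  have h := koszul (g := g) hb hX (hY.diffAt x) hZ
  -- Subtracting the formula with `X` and `Y` exchanged leaves only `2g([X, Y], Z)`.
  have h' := koszul (g := g) hb hY (hX.diffAt x) hZ
  rw [g.eval_comm Y X, lieBr_swap Y X] at h'
  simp only [map_sub, map_neg, sub_apply, neg_apply] at h' ⊢
  linarith

/-- `∇⁺` is metric when `db = 0`. -/
theorem nablaPlus_metric (hb : b.IsClosed) (hX : SmoothVField X) (hY : SmoothVField Y)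
    (hZ : SmoothVField Z) :
    dirDeriv X (g.eval Y Z) x =
      g.val x (nablaPlus g b X Y x) (Z x) + g.val x (Y x) (nablaPlus g b X Z x) := by
  have h := koszul (g := g) hb hX (hY.diffAt x) hZ
  -- Adding the formula with `Y` and `Z` exchanged leaves only `2X(g(Y, Z))`.
  have h' := koszul (g := g) hb hX (hZ.diffAt x) hY
  rw [g.eval_comm Z Y, lieBr_swap Z Y] at h'
  simp only [map_neg, neg_apply] at h'
  rw [g.symm x (Y x)]
  linarith

theorem covForm_add (hb : b.IsClosed) (hX : SmoothVField X) (hξ : SmoothOneForm ξ)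
    (hη : SmoothOneForm η) :
    covForm (nablaPlus g b) X (fun y ↦ ξ y + η y) x =
      covForm (nablaPlus g b) X ξ x + covForm (nablaPlus g b) X η x := by
  refine form_ext_smooth fun Z hZ ↦ ?_
  have hZx := hZ.diffAt x
  have hξx := hξ.diffAt x
  have hηx := hη.diffAt x
  have h : evalForm (fun y ↦ ξ y + η y) Z = fun y ↦ evalForm ξ Z y + evalForm η Z y := rfl
  rw [add_apply, covForm_apply hb hX hξx hZx, covForm_apply hb hX hηx hZx,
    covForm_apply hb hX (hξx.add hηx) hZx, h,
    dirDeriv_add (hξx.evalForm hZx) (hηx.evalForm hZx), add_apply]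
  ring

theorem covForm_neg (hb : b.IsClosed) (hX : SmoothVField X) (hξ : SmoothOneForm ξ) :
    covForm (nablaPlus g b) X (fun y ↦ -ξ y) x = -covForm (nablaPlus g b) X ξ x := by
  refine form_ext_smooth fun Z hZ ↦ ?_
  have hZx := hZ.diffAt x
  have hξx := hξ.diffAt x
  have h : evalForm (fun y ↦ -ξ y) Z = fun y ↦ -evalForm ξ Z y := rfl
  rw [neg_apply, covForm_apply hb hX hξx hZx, covForm_apply hb hX hξx.neg hZx, h,
    dirDeriv_neg, neg_apply]
  ring

theorem covForm_metric (hb : b.IsClosed) (hX : SmoothVField X) (hY : SmoothVField Y) :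
    covForm (nablaPlus g b) X (fun y ↦ g.val y (Y y)) x = g.val x (nablaPlus g b X Y x) := by
  refine form_ext_smooth fun Z hZ ↦ ?_
  rw [covForm_apply hb hX (g.smoothBilin.apply_diffAt (hY.diffAt x)) (hZ.diffAt x)]
  exact sub_eq_of_eq_add (nablaPlus_metric hb hX hY hZ)

theorem covForm_twoForm (hb : b.IsClosed) (hpar : b.IsParallel (nablaPlus g b))
    (hX : SmoothVField X) (hY : SmoothVField Y) :
    covForm (nablaPlus g b) X (fun y ↦ b.val y (Y y)) x = b.val x (nablaPlus g b X Y x) := by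
  refine form_ext_smooth fun Z hZ ↦ ?_
  rw [covForm_apply hb hX (b.smoothBilin.apply_diffAt (hY.diffAt x)) (hZ.diffAt x)]
  have h := hpar X Y Z hX hY hZ x
  simp only [TwoForm.eval] at h
  change dirDeriv X (b.eval Y Z) x - _ = _
  linarith

/-- The inverse of a parallel isomorphism is parallel: apply `covForm_metric` to the field `g⁻¹ξ`.
-/
theorem nablaPlus_inverse (hb : b.IsClosed) (hX : SmoothVField X) (hξ : SmoothOneForm ξ) :
    nablaPlus g b X (fun y ↦ (g.val y).inverse (ξ y)) x =
      (g.val x).inverse (covForm (nablaPlus g b) X ξ x) := by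
  have h := covForm_metric (g := g) (x := x) hb hX (g.smooth_inverse hξ)
  simp only [g.val_inverse] at h
  rw [h, g.inverse_val]

theorem genMetric_app_smooth {v : GenField E M} (hv : SmoothGenField v) :
    SmoothGenField ((genMetric g b).app v) := by
  have h := g.smooth_inverse (hv.2.add (b.smoothBilin.apply hv.1).neg)
  simp only [← sub_eq_add_neg] at h
  refine ⟨?_, ?_⟩
  · simpa only [GenEndo.app, genMetric_apply] using h
  · simpa only [GenEndo.app, genMetric_apply] using
      (g.smoothBilin.apply hv.1).add (b.smoothBilin.apply h)

/-- The endomorphism `G` is parallel for the generalized connection induced by `∇⁺`. -/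
theorem genConn_genMetric (hb : b.IsClosed) (hpar : b.IsParallel (nablaPlus g b))
    {v w : GenField E M} (hv : SmoothGenField v) (hw : SmoothGenField w) :
    genConn (nablaPlus g b) v ((genMetric g b).app w) x =
      genMetric g b x (genConn (nablaPlus g b) v w x) := by
  -- Both components of `Gw` are built from `g⁻¹(η - bY)`, where `w = Y + η`; the derivative passes
  -- through `b`, `g⁻¹` and `g` in turn.
  have hs := hw.2.add (b.smoothBilin.apply hw.1).neg
  have h := g.smooth_inverse hs
  have hc : covForm (nablaPlus g b) (fun y ↦ (v y).1) (fun y ↦ (w y).2 + -b.val y (w y).1) x =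
      covForm (nablaPlus g b) (fun y ↦ (v y).1) (fun y ↦ (w y).2) x
        - b.val x (nablaPlus g b (fun y ↦ (v y).1) (fun y ↦ (w y).1) x) := by
    rw [covForm_add hb hv.1 hw.2 (b.smoothBilin.apply hw.1).neg,
      covForm_neg hb hv.1 (b.smoothBilin.apply hw.1), covForm_twoForm hb hpar hv.1 hw.1,
      sub_eq_add_neg]
  simp only [GenEndo.app, genMetric_apply, genConn, sub_eq_add_neg]
  rw [nablaPlus_inverse hb hv.1 hs, covForm_add hb hv.1 (g.smoothBilin.apply hw.1)
    (b.smoothBilin.apply h), covForm_metric hb hv.1 hw.1, covForm_twoForm hb hpar hv.1 h,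
    nablaPlus_inverse hb hv.1 hs, hc, sub_eq_add_neg]

theorem connBracket_eq (hb : b.IsClosed) {v w : GenField E M} (hv : SmoothGenField v)
    (hw : SmoothGenField w) :
    connBracket (nablaPlus g b) v w x =
      genConn (nablaPlus g b) v w x - genConn (nablaPlus g b) w v x := by
  rw [connBracket, nablaPlus_torsionFree (g := g) hb hv.1 hw.1]
  rfl

theorem nijenhuisIntegrable (hb : b.IsClosed) (hpar : b.IsParallel (nablaPlus g b)) :
    NijenhuisIntegrable (connBracket (nablaPlus g b)) (genMetric g b) := by
  intro v w hv hw x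
  have hGv := genMetric_app_smooth (g := g) (b := b) hv
  have hGw := genMetric_app_smooth (g := g) (b := b) hw
  -- Each bracket splits into two derivatives; once `G` is pulled out of them, the eight terms
  -- cancel in pairs.
  rw [nijenhuis, connBracket_eq hb hGv hGw, connBracket_eq hb hGv hw, connBracket_eq hb hv hGw,
    connBracket_eq hb hv hw, genConn_genMetric hb hpar hGv hw, genConn_genMetric hb hpar hGw hv,
    genConn_genMetric hb hpar hw hv, genConn_genMetric hb hpar hv hw]
  have hG (a c : GenFiber E x) :
      genMetric g b x (a - c) = genMetric g b x a - genMetric g b x c :=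
    ContinuousLinearMap.map_sub _ a c
  simp only [hG]
  abel

/-! ### Courant integrability -/

theorem IsPlusSection.eq_liftPlus {v : GenField E M} (hv : IsPlusSection (genMetric g b) v) :
    v = liftPlus g b (fun y ↦ (v y).1) :=
  funext fun y ↦ Prod.ext rfl ((genMetric_eq_self_iff _).1 (hv.2 y))

/-- As `g` and `b` are parallel, `∇̃_u X⁺ = (∇_{πu}X)⁺`; in the pairing of two lifts the `b`-terms
cancel by skewness and the `g`-terms double. -/
theorem pairing_genConn_liftPlus (hb : b.IsClosed) (hpar : b.IsParallel (nablaPlus g b))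
    {u : GenField E M} (hu : SmoothVField fun y ↦ (u y).1) (hX : SmoothVField X)
    (Y : VField E M) (x : M) :
    pairing (genConn (nablaPlus g b) u (liftPlus g b X) x) (liftPlus g b Y x) =
      2 * g.val x (nablaPlus g b (fun y ↦ (u y).1) X x) (Y x) := by
  have h : covForm (nablaPlus g b) (fun y ↦ (u y).1) (fun y ↦ g.val y (X y) + b.val y (X y)) x =
      g.val x (nablaPlus g b (fun y ↦ (u y).1) X x)
        + b.val x (nablaPlus g b (fun y ↦ (u y).1) X x) := by
    rw [covForm_add hb hu (g.smoothBilin.apply hX) (b.smoothBilin.apply hX),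
      covForm_metric hb hu hX, covForm_twoForm hb hpar hu hX]
  simp only [pairing, genConn, liftPlus, h, add_apply]
  rw [g.symm x (Y x), b.skew x (Y x)]
  ring

/-- Torsion-freeness moves the sign into the differentiated slot, where the Leibniz rule for the
constant function -1 applies. -/
theorem nablaPlus_neg_left (hb : b.IsClosed) (hX : SmoothVField X) (hY : SmoothVField Y) :
    nablaPlus g b (fun y ↦ -X y) Y x = -nablaPlus g b X Y x := by
  have h₁ := nablaPlus_torsionFree (g := g) (x := x) hb hX hY
  have h₂ := nablaPlus_torsionFree (g := g) (x := x) hb hX.neg hY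
  have hc : FunDiffAt (E := E) (fun _ : M ↦ (-1 : ℝ)) x := mdifferentiableAt_const
  have h₃ := nablaPlus_smul (g := g) hb hY hc (hX.diffAt x)
  have h₄ := lieBr_smul_left (X := Y) hc (hX.diffAt x)
  have h₅ : dirDeriv Y (fun _ : M ↦ (-1 : ℝ)) x = 0 := by
    rw [dirDeriv, mvfderiv_const]; rfl
  simp only [h₅, neg_smul, one_smul, zero_smul, zero_add, neg_zero] at h₃ h₄
  rw [h₄, h₃, h₁] at h₂
  rw [← sub_eq_zero] at h₂ ⊢
  rw [← neg_eq_zero, ← h₂]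
  abel

/-- The symmetry condition on sections of `V⁺` says that `g(∇⁺X, Y) = 0`. -/
theorem SymmCondition.val_nablaPlus_eq_zero (hb : b.IsClosed)
    (hpar : b.IsParallel (nablaPlus g b)) (hX : SmoothVField X)
    (h : SymmCondition g b (liftPlus g b X) (liftPlus g b Y)) (hZ : SmoothVField Z) (x : M) :
    g.val x (nablaPlus g b Z X x) (Y x) = 0 := by
  -- The test section `Z⁻` has eigenvalue -1 and `Y⁺` has eigenvalue 1, so the condition equates
  -- `2g(∇_Z X, Y)` with its negative.
  have hu : SmoothGenField (liftMinus g b Z) :=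
    ⟨hZ, (g.smoothBilin.apply hZ).neg.add (b.smoothBilin.apply hZ)⟩
  have hGu : (fun y ↦ ((genMetric g b).app (liftMinus g b Z) y).1) = fun y ↦ -Z y := by
    ext y
    simp [GenEndo.app, genMetric_apply, liftMinus, g.inverse_val]
  have hGw : (genMetric g b).app (liftPlus g b Y) = liftPlus g b Y :=
    funext fun y ↦ (genMetric_eq_self_iff _).2 rfl
  have h' := h _ hu x
  rw [hGw, pairing_genConn_liftPlus hb hpar hu.1 hX,
    pairing_genConn_liftPlus hb hpar (genMetric_app_smooth hu).1 hX, hGu,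
    nablaPlus_neg_left hb hZ hX] at h'
  simp only [map_neg, neg_apply, liftMinus] at h'
  linarith

theorem courant_mem_plus (hb : b.IsClosed) (hpar : b.IsParallel (nablaPlus g b))
    {v w : GenField E M} (hv : IsPlusSection (genMetric g b) v)
    (hw : IsPlusSection (genMetric g b) w) (hvw : SymmCondition g b v w)
    (hwv : SymmCondition g b w v) (x : M) :
    genMetric g b x (courant v w x) = courant v w x := by
  obtain ⟨X, hX, rfl⟩ : ∃ X, SmoothVField X ∧ v = liftPlus g b X := ⟨_, hv.1.1, hv.eq_liftPlus⟩
  obtain ⟨Y, hY, rfl⟩ : ∃ Y, SmoothVField Y ∧ w = liftPlus g b Y := ⟨_, hw.1.1, hw.eq_liftPlus⟩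
  have hfst : (courant (liftPlus g b X) (liftPlus g b Y) x).1 = lieBr X Y x := fst_courant ..
  rw [genMetric_eq_self_iff, hfst]
  refine form_ext_smooth fun Z hZ ↦ ?_
  have hXx := hX.diffAt x
  have hYx := hY.diffAt x
  have hZx := hZ.diffAt x
  have hc := two_snd_courant_apply (hv.1.2.diffAt x) (hw.1.2.diffAt x) hZx
  have h₁ (X Z : VField E M) : evalForm (fun y ↦ (liftPlus g b X y).2) Z =
      fun y ↦ g.eval X Z y + b.eval X Z y := rfl
  have hd := hb X Y Z hX hY hZ x
  -- Half the difference of these two formulas is the `g`-part of the defect on `Z`; the `b`-part is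
  -- `db(X, Y, Z)`, removed by `hd`. The symmetry conditions make both left sides zero.
  have k₁ := koszul (g := g) hb hZ hXx hY
  have k₂ := koszul (g := g) hb hZ hYx hX
  rw [hvw.val_nablaPlus_eq_zero hb hpar hX hZ] at k₁
  rw [hwv.val_nablaPlus_eq_zero hb hpar hY hZ] at k₂
  have e₁ : evalForm (fun y ↦ (liftPlus g b Y y).2) (fun y ↦ (liftPlus g b X y).1) =
      fun y ↦ g.eval X Y y - b.eval X Y y := by
    rw [g.eval_comm, b.eval_swap X Y]
    ext; simp [evalForm, liftPlus, PseudoMetric.eval, TwoForm.eval]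
  have e₂ : evalForm (fun y ↦ (liftPlus g b X y).2) (fun y ↦ (liftPlus g b Y y).1) =
      fun y ↦ g.eval X Y y + b.eval X Y y := rfl
  rw [e₁, e₂, h₁, h₁, dirDeriv_add (g.eval_diffAt hYx hZx) (b.eval_diffAt hYx hZx),
    dirDeriv_add (g.eval_diffAt hXx hZx) (b.eval_diffAt hXx hZx),
    dirDeriv_add (g.eval_diffAt hXx hYx) (b.eval_diffAt hXx hYx),
    dirDeriv_sub (g.eval_diffAt hXx hYx) (b.eval_diffAt hXx hYx)] at hc
  rw [b.eval_swap Z X, dirDeriv_neg] at hd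
  rw [g.eval_comm Z X, g.eval_comm Z Y, lieBr_swap Z X, lieBr_swap Z Y] at k₁ k₂
  rw [g.eval_comm Y X, lieBr_swap Y X] at k₂
  simp only [liftPlus, TwoForm.eval, lieBr_swap Z X, map_neg, neg_apply, add_apply]
    at hc hd k₁ k₂ ⊢
  linarith [g.symm x (Y x) (lieBr X Z x), b.skew x (Y x) (lieBr X Z x),
    g.symm x (X x) (lieBr Y Z x), b.skew x (X x) (lieBr Y Z x)]

end LeviCivita

end GenGeom

theorem mainTheorem7
    {E : Type*} [NormedAddCommGroup E] [NormedSpace ℝ E] [FiniteDimensional ℝ E]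
    {M : Type*} [TopologicalSpace M] [T2Space M] [SecondCountableTopology M]
    [ChartedSpace E M] [IsManifold 𝓘(ℝ, E) ∞ M]
    (g : GenGeom.PseudoMetric E M) (b : GenGeom.TwoForm E M)
    (hpar : b.IsParallel (GenGeom.nablaPlus g b)) (hclosed : b.IsClosed) :
    GenGeom.NijenhuisIntegrable (GenGeom.connBracket (GenGeom.nablaPlus g b))
        (GenGeom.genMetric g b) ∧
      ((∀ v w : GenGeom.GenField E M, GenGeom.SmoothGenField v → GenGeom.SmoothGenField w →
          GenGeom.SymmCondition g b v w) →
        GenGeom.CourantIntegrable (GenGeom.genMetric g b)) ∧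
      (∀ v w : GenGeom.GenField E M,
        GenGeom.IsPlusSection (GenGeom.genMetric g b) v →
        GenGeom.IsPlusSection (GenGeom.genMetric g b) w →
        GenGeom.SymmCondition g b v w → GenGeom.SymmCondition g b w v →
          ∀ x, GenGeom.genMetric g b x (GenGeom.courant v w x) = GenGeom.courant v w x) :=
  ⟨GenGeom.nijenhuisIntegrable hclosed hpar,
    fun h _ _ hv hw ↦ GenGeom.courant_mem_plus hclosed hpar hv hw (h _ _ hv.1 hw.1)
      (h _ _ hw.1 hv.1),
    fun _ _ hv hw hvw hwv ↦ GenGeom.courant_mem_plus hclosed hpar hv hw hvw hwv⟩
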